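/- Let $n\ge 1$, $0<p\le 1$, and let $Z\in\mathbb R^{n\times n}$ be a fixed matrix. Let $\Omega\subseteq\{1,\dots,n\}^2$ be a random set that contains each index $(i,j)$ with probability $p$, independently of all other indices. Define the matrix $\mathcal R_\Omega Z$ by $(\mathcal R_\Omega Z)_{ij}=\frac1p Z_{ij}$ if $(i,j)\in\Omega$ and $(\mathcal R_\Omega Z)_{ij}=0$ otherwise, and let $\mathcal I$ be the identity map on matrices. Write $\|\cdot\|$ for the spectral norm, $$\|Z\|_\infty=\max_{i,j}|Z_{ij}|,\qquad \|Z\|_{\infty,2}=\max\Big\{\max_i\sqrt{\textstyle\sum_b Z_{ib}^2},\ \max_j\sqrt{\textstyle\sum_a Z_{aj}^2}\Big\}.$$ Then the following bound holds with high probability: for every $c_2>0$ there are constants $c>1$ and $c_1>0$, depending only on $c_2$ (in particular not on $n$, $p$ or $Z$), such that with probability at least $1-c_1n^{-c_2}$ $$\|(\mathcal R_\Omega-\mathcal I)Z\|\le c\left(\frac{\log n}{p}\|Z\|_\infty+\sqrt{\frac{\log n}{p}}\,\|Z\|_{\infty,2}\right).$$ -/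

import Mathlib

open MeasureTheory ProbabilityTheory

noncomputable section

namespace MatrixSampling

/-- The matrix `ℓ_∞` norm: the largest absolute value of an entry. -/
def normInf {n : ℕ} (Z : Matrix (Fin n) (Fin n) ℝ) : ℝ :=
  ⨆ ij : Fin n × Fin n, |Z ij.1 ij.2|

/-- The matrix `ℓ_{∞,2}` norm: the largest Euclidean norm of a row or column. -/
def normInfTwo {n : ℕ} (Z : Matrix (Fin n) (Fin n) ℝ) : ℝ :=
  max (⨆ i : Fin n, √(∑ b, Z i b ^ 2)) (⨆ j : Fin n, √(∑ a, Z a j ^ 2))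

/-- The spectral norm: the operator norm with respect to the Euclidean norm on `ℝⁿ`. -/
def specNorm {n : ℕ} (Z : Matrix (Fin n) (Fin n) ℝ) : ℝ :=
  ‖Matrix.toEuclideanCLM (n := Fin n) (𝕜 := ℝ) Z‖

open Classical in
/-- `P_S Z` keeps the entries of `Z` with index in `S` and sets the others to zero. -/
def projOn {n : ℕ} (S : Set (Fin n × Fin n)) (Z : Matrix (Fin n) (Fin n) ℝ) :
    Matrix (Fin n) (Fin n) ℝ :=
  Matrix.of fun i j => if (i, j) ∈ S then Z i j else 0

/-- `R_S Z = p⁻¹ P_S Z`. -/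
def rescaledProjOn {n : ℕ} (p : ℝ) (S : Set (Fin n × Fin n)) (Z : Matrix (Fin n) (Fin n) ℝ) :
    Matrix (Fin n) (Fin n) ℝ :=
  (1 / p) • projOn S Z

/-- The random index set `S` follows the Bernoulli(`p`) model: each index belongs to `S` with
probability `p`, independently of all the others. -/
structure IsBernoulliSampling {E : Type*} [MeasurableSpace E] (P : Measure E) {n : ℕ} (p : ℝ)
    (S : E → Set (Fin n × Fin n)) : Prop where
  measurableSet_mem : ∀ ij, MeasurableSet {ω | ij ∈ S ω}
  prob_mem : ∀ ij, P.real {ω | ij ∈ S ω} = p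
  indep : iIndepSet (fun ij => {ω | ij ∈ S ω}) P

end MatrixSampling

end

/-!
The error `R_Ω Z - Z` is the sum over all entries of the matrices `Z i j • E_ij`, weighted by
independent centred noises that are bounded by `1 / p` and have variance at most `1 / p`, so the
bound is an instance of the matrix Bernstein inequality.

For Hermitian matrices `A k` and noises `ξ k` of variance at most `v`, write each
`θ ξ A` as `(θ ξ A - θ² v A²) + θ² v A²`. By the Golden–Thompson inequality the exponential of the
bracket splits off as a factor under the trace; being a function of `A` alone, it is diagonal in an
eigenbasis of `A`, where each diagonal entry has mean at most `1`. Hence `𝔼 tr exp (∑ θ ξ A)` is at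
most `tr exp (θ² v ∑ A²)`, by replacing one summand at a time, and Markov's inequality gives the
tail bound. Rectangular matrices are reduced to Hermitian ones by the dilation `[0, B; Bᴴ, 0]`,
whose square is `[B Bᴴ, 0; 0, Bᴴ B]`. Finally `θ = √ℓ / (√ℓ R L + √v σ)` with `ℓ = log n` balances
the two terms of the bound.
-/

namespace MatrixSampling

open Filter Topology
open scoped ComplexOrder Matrix Matrix.Norms.L2Operator

section LieProduct

theorem norm_pow_sub_pow_le {𝔸 : Type*} [NormedRing 𝔸] [NormOneClass 𝔸] {x y : 𝔸} {r : ℝ}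
    (hx : ‖x‖ ≤ r) (hy : ‖y‖ ≤ r) (n : ℕ) : ‖x ^ n - y ^ n‖ ≤ n * ‖x - y‖ * r ^ (n - 1) := by
  have hr : 0 ≤ r := (norm_nonneg x).trans hx
  induction n with
  | zero => simp
  | succ n ih =>
    have hsplit : x ^ (n + 1) - y ^ (n + 1) = (x ^ n - y ^ n) * x + y ^ n * (x - y) := by
      rw [pow_succ x, pow_succ y]
      noncomm_ring
    have hpow : n * r ^ (n - 1) * r = n * r ^ n := by
      cases n <;> simp [pow_succ, mul_assoc]
    calc ‖x ^ (n + 1) - y ^ (n + 1)‖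
        ≤ ‖x ^ n - y ^ n‖ * ‖x‖ + ‖y ^ n‖ * ‖x - y‖ := by
          rw [hsplit]
          exact (norm_add_le _ _).trans (add_le_add (norm_mul_le _ _) (norm_mul_le _ _))
      _ ≤ n * ‖x - y‖ * r ^ (n - 1) * r + r ^ n * ‖x - y‖ := by
          gcongr
          exact (norm_pow_le y n).trans (by gcongr)
      _ = (n + 1 : ℕ) * ‖x - y‖ * r ^ (n + 1 - 1) := by
          rw [Nat.add_sub_cancel]
          push_cast
          linear_combination ‖x - y‖ * hpow

variable {𝔸 : Type*} [NormedRing 𝔸] [NormedAlgebra ℝ 𝔸] [CompleteSpace 𝔸]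

theorem norm_exp_le_exp_norm [NormOneClass 𝔸] (x : 𝔸) : ‖NormedSpace.exp x‖ ≤ Real.exp ‖x‖ := by
  have hreal := NormedSpace.exp_series_hasSum_exp' (𝕂 := ℝ) ‖x‖
  rw [← Real.exp_eq_exp_ℝ] at hreal
  rw [← (NormedSpace.exp_series_hasSum_exp' (𝕂 := ℝ) x).tsum_eq]
  refine tsum_of_norm_bounded hreal fun n => ?_
  rw [norm_smul, Real.norm_of_nonneg (by positivity), smul_eq_mul]
  gcongr
  exact norm_pow_le x n

theorem exp_inv_smul_pow (a : 𝔸) {n : ℕ} (hn : n ≠ 0) :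
    NormedSpace.exp ((n : ℝ)⁻¹ • a) ^ n = NormedSpace.exp a := by
  let _ : NormedAlgebra ℚ 𝔸 := .restrictScalars ℚ ℝ 𝔸
  rw [← NormedSpace.exp_nsmul, ← Nat.cast_smul_eq_nsmul ℝ,
    smul_inv_smul₀ (Nat.cast_ne_zero.2 hn)]

theorem hasDerivAt_exp_mul_exp_sub_exp_add (a b : 𝔸) :
    HasDerivAt (fun t : ℝ => NormedSpace.exp (t • a) * NormedSpace.exp (t • b) -
      NormedSpace.exp (t • (a + b))) 0 0 := by
  have hexp (c : 𝔸) : HasDerivAt (fun t : ℝ => NormedSpace.exp (t • c)) c 0 := by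
    simpa using hasDerivAt_exp_smul_const (𝕂 := ℝ) c (0 : ℝ)
  simpa using ((hexp a).fun_mul (hexp b)).fun_sub (hexp (a + b))

theorem tendsto_exp_mul_exp_pow [NormOneClass 𝔸] (a b : 𝔸) :
    Tendsto (fun n : ℕ => (NormedSpace.exp ((n : ℝ)⁻¹ • a) * NormedSpace.exp ((n : ℝ)⁻¹ • b)) ^ n)
      atTop (𝓝 (NormedSpace.exp (a + b))) := by
  set err : ℝ → 𝔸 := fun t => NormedSpace.exp (t • a) * NormedSpace.exp (t • b) -
    NormedSpace.exp (t • (a + b))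
  have herr : Tendsto (fun n : ℕ => n * ‖err (n : ℝ)⁻¹‖ * Real.exp (‖a‖ + ‖b‖)) atTop (𝓝 0) := by
    have hslope := (hasDerivAt_iff_tendsto_slope_zero.1
      (hasDerivAt_exp_mul_exp_sub_exp_add a b)).comp
      (tendsto_inv_atTop_nhdsGT_zero.mono_right (nhdsGT_le_nhdsNE 0) |>.comp
        tendsto_natCast_atTop_atTop)
    simpa [err, norm_smul, Function.comp_def] using hslope.norm.mul_const (Real.exp (‖a‖ + ‖b‖))
  rw [tendsto_iff_norm_sub_tendsto_zero]
  refine squeeze_zero' (.of_forall fun _ => norm_nonneg _) ?_ herr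
  filter_upwards [eventually_ne_atTop 0] with n hn
  have hnorm (c : 𝔸) : ‖(n : ℝ)⁻¹ • c‖ = (n : ℝ)⁻¹ * ‖c‖ := by simp [norm_smul]
  have hprod : ‖NormedSpace.exp ((n : ℝ)⁻¹ • a) * NormedSpace.exp ((n : ℝ)⁻¹ • b)‖ ≤
      Real.exp ((n : ℝ)⁻¹ * (‖a‖ + ‖b‖)) := by
    rw [mul_add, Real.exp_add, ← hnorm, ← hnorm]
    exact (norm_mul_le _ _).trans (by gcongr <;> exact norm_exp_le_exp_norm _)
  have hsum : ‖NormedSpace.exp ((n : ℝ)⁻¹ • (a + b))‖ ≤ Real.exp ((n : ℝ)⁻¹ * (‖a‖ + ‖b‖)) := by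
    refine (norm_exp_le_exp_norm _).trans ?_
    rw [hnorm]
    gcongr
    exact norm_add_le a b
  have hpow : Real.exp ((n : ℝ)⁻¹ * (‖a‖ + ‖b‖)) ^ (n - 1) ≤ Real.exp (‖a‖ + ‖b‖) := by
    refine (pow_le_pow_right₀ (Real.one_le_exp (by positivity)) n.pred_le).trans_eq ?_
    rw [← Real.exp_nat_mul, mul_inv_cancel_left₀ (Nat.cast_ne_zero.2 hn)]
  rw [← exp_inv_smul_pow (a + b) hn]
  exact (norm_pow_sub_pow_le hprod hsum n).trans (by gcongr)

end LieProduct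

section GoldenThompson

variable {𝕜 d : Type*} [RCLike 𝕜] [Fintype d]

theorem re_trace_mul_le (X Y : Matrix d d 𝕜) :
    RCLike.re (X * Y).trace ≤
      (RCLike.re (Xᴴ * X).trace + RCLike.re (Yᴴ * Y).trace) / 2 := by
  have hnonneg : 0 ≤ RCLike.re ((X - Yᴴ)ᴴ * (X - Yᴴ)).trace :=
    (RCLike.nonneg_iff.1 (Matrix.posSemidef_conjTranspose_mul_self (X - Yᴴ)).trace_nonneg).1
  have hconj : RCLike.re (Xᴴ * Yᴴ).trace = RCLike.re (X * Y).trace := by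
    rw [← Matrix.conjTranspose_mul, Matrix.trace_conjTranspose, Matrix.trace_mul_comm Y X,
      RCLike.star_def, RCLike.conj_re]
  simp only [Matrix.conjTranspose_sub, Matrix.conjTranspose_conjTranspose, sub_mul, mul_sub,
    Matrix.trace_sub, map_sub, hconj, Matrix.trace_mul_comm Y X, Matrix.trace_mul_comm Y Yᴴ]
    at hnonneg
  linarith

variable [DecidableEq d]

theorem trace_mul_pow_comm {R : Type*} [CommSemiring R] (X Y : Matrix d d R) (k : ℕ) :
    ((X * Y) ^ k).trace = ((Y * X) ^ k).trace := by
  cases k with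
  | zero => simp
  | succ k =>
    rw [pow_succ, ← mul_assoc, mul_pow_mul, mul_assoc, Matrix.trace_mul_comm, mul_assoc,
      ← pow_succ]

-- The two inequalities feed each other: the first for `k` gives the second for `k + 1`, and
-- both for `k` give the first for `k + 1`.
theorem re_trace_pow_two_pow_le_and_re_trace_mul_pow_two_pow_le (k : ℕ) :
    (∀ M : Matrix d d 𝕜,
      RCLike.re (M ^ 2 ^ (k + 1)).trace ≤ RCLike.re ((Mᴴ * M) ^ 2 ^ k).trace) ∧
    (∀ P Q : Matrix d d 𝕜, P.IsHermitian → Q.IsHermitian →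
      RCLike.re ((P * Q) ^ 2 ^ k).trace ≤ RCLike.re (P ^ 2 ^ k * Q ^ 2 ^ k).trace) := by
  induction k with
  | zero => exact ⟨fun M => by simpa [pow_two] using re_trace_mul_le M M, fun P Q _ _ => by simp⟩
  | succ k ih =>
    obtain ⟨ih_pow, ih_mul⟩ := ih
    refine ⟨fun M => ?_, fun P Q hP hQ => ?_⟩
    · have hP := Matrix.isHermitian_conjTranspose_mul_self M
      have hQ := Matrix.isHermitian_mul_conjTranspose_self M
      calc RCLike.re (M ^ 2 ^ (k + 1 + 1)).trace
          = RCLike.re ((M ^ 2) ^ 2 ^ (k + 1)).trace := by rw [← pow_mul, ← pow_succ']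
        _ ≤ RCLike.re (((M ^ 2)ᴴ * M ^ 2) ^ 2 ^ k).trace := ih_pow _
        _ = RCLike.re ((Mᴴ * (Mᴴ * M * M)) ^ 2 ^ k).trace := by
            simp only [pow_two, Matrix.conjTranspose_mul, mul_assoc]
        _ = RCLike.re ((Mᴴ * M * (M * Mᴴ)) ^ 2 ^ k).trace := by
            rw [trace_mul_pow_comm]
            simp only [mul_assoc]
        _ ≤ RCLike.re ((Mᴴ * M) ^ 2 ^ k * (M * Mᴴ) ^ 2 ^ k).trace := ih_mul _ _ hP hQ
        _ ≤ (RCLike.re ((Mᴴ * M) ^ 2 ^ (k + 1)).trace +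
              RCLike.re ((M * Mᴴ) ^ 2 ^ (k + 1)).trace) / 2 := by
            refine (re_trace_mul_le _ _).trans_eq ?_
            rw [(hP.pow _).eq, (hQ.pow _).eq, ← pow_add, ← pow_add, ← two_mul, ← pow_succ']
        _ = RCLike.re ((Mᴴ * M) ^ 2 ^ (k + 1)).trace := by
            rw [trace_mul_pow_comm M Mᴴ, add_self_div_two]
    · calc RCLike.re ((P * Q) ^ 2 ^ (k + 1)).trace
          ≤ RCLike.re (((P * Q)ᴴ * (P * Q)) ^ 2 ^ k).trace := ih_pow _
        _ = RCLike.re ((Q * (P ^ 2 * Q)) ^ 2 ^ k).trace := by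
            rw [Matrix.conjTranspose_mul, hP.eq, hQ.eq, pow_two]
            simp only [mul_assoc]
        _ = RCLike.re ((P ^ 2 * Q ^ 2) ^ 2 ^ k).trace := by
            rw [trace_mul_pow_comm, pow_two Q]
            simp only [mul_assoc]
        _ ≤ RCLike.re ((P ^ 2) ^ 2 ^ k * (Q ^ 2) ^ 2 ^ k).trace := ih_mul _ _ (hP.pow 2) (hQ.pow 2)
        _ = RCLike.re (P ^ 2 ^ (k + 1) * Q ^ 2 ^ (k + 1)).trace := by
            rw [← pow_mul, ← pow_mul, ← pow_succ']

theorem re_trace_mul_pow_two_pow_le {P Q : Matrix d d 𝕜} (hP : P.IsHermitian)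
    (hQ : Q.IsHermitian) (k : ℕ) :
    RCLike.re ((P * Q) ^ 2 ^ k).trace ≤ RCLike.re (P ^ 2 ^ k * Q ^ 2 ^ k).trace :=
  (re_trace_pow_two_pow_le_and_re_trace_mul_pow_two_pow_le k).2 P Q hP hQ

/-- Mathlib provides the `𝕜`-algebra structure for the spectral norm; probability needs the real
one. -/
noncomputable scoped instance l2OpNormedAlgebraReal : NormedAlgebra ℝ (Matrix d d 𝕜) where
  norm_smul_le r A := by
    rw [RCLike.real_smul_eq_coe_smul (K := 𝕜), norm_smul, RCLike.norm_ofReal, Real.norm_eq_abs]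

theorem continuous_exp : Continuous (NormedSpace.exp : Matrix d d 𝕜 → Matrix d d 𝕜) :=
  let _ : NormedAlgebra ℚ (Matrix d d 𝕜) := .restrictScalars ℚ ℝ _
  NormedSpace.exp_continuous

theorem continuous_re_trace_exp :
    Continuous fun M : Matrix d d 𝕜 => RCLike.re (NormedSpace.exp M).trace :=
  RCLike.continuous_re.comp continuous_exp.matrix_trace

theorem re_trace_exp_add_le {A B : Matrix d d 𝕜} (hA : A.IsHermitian) (hB : B.IsHermitian) :
    RCLike.re (NormedSpace.exp (A + B)).trace ≤
      RCLike.re (NormedSpace.exp A * NormedSpace.exp B).trace := by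
  cases isEmpty_or_nonempty d
  · simp [Matrix.trace]
  have hpow : Tendsto (fun k : ℕ => 2 ^ k) atTop atTop :=
    tendsto_pow_atTop_atTop_of_one_lt one_lt_two
  have hcont : Continuous fun M : Matrix d d 𝕜 => RCLike.re M.trace :=
    RCLike.continuous_re.comp continuous_id.matrix_trace
  refine le_of_tendsto ((hcont.tendsto _).comp ((tendsto_exp_mul_exp_pow A B).comp hpow))
    (.of_forall fun k => ?_)
  have hexp (C : Matrix d d 𝕜) :=
    exp_inv_smul_pow C (pow_ne_zero k (two_ne_zero (α := ℕ)))
  have hscaled {C : Matrix d d 𝕜} (hC : C.IsHermitian) (r : ℝ) :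
      (NormedSpace.exp (r • C)).IsHermitian :=
    (hC.smul (IsSelfAdjoint.all r)).exp
  rw [← hexp A, ← hexp B]
  exact re_trace_mul_pow_two_pow_le (hscaled hA _) (hscaled hB _) k

end GoldenThompson

section Spectral

variable {𝕜 d : Type*} [RCLike 𝕜] [Fintype d] [DecidableEq d] {A : Matrix d d 𝕜}

/-- The real parts of the diagonal entries of `M` in an eigenbasis of the Hermitian matrix `A`;
they are the weights of the eigenvalues of `A` in the traces `tr (M f(A))`. -/
noncomputable def eigenbasisDiag (hA : A.IsHermitian) (M : Matrix d d 𝕜) (i : d) : ℝ :=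
  RCLike.re ((star (hA.eigenvectorUnitary : Matrix d d 𝕜) * M * hA.eigenvectorUnitary) i i)

theorem re_trace_mul_cfc (hA : A.IsHermitian) (M : Matrix d d 𝕜) (f : ℝ → ℝ) :
    RCLike.re (M * cfc f A).trace = ∑ i, f (hA.eigenvalues i) * eigenbasisDiag hA M i := by
  rw [hA.cfc_eq, Matrix.IsHermitian.cfc, Unitary.conjStarAlgAut_apply, ← mul_assoc,
    Matrix.trace_mul_comm, ← mul_assoc, ← mul_assoc, Matrix.trace, map_sum]
  simp [eigenbasisDiag, Matrix.mul_diagonal, mul_comm]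

theorem sum_eigenbasisDiag (hA : A.IsHermitian) (M : Matrix d d 𝕜) :
    ∑ i, eigenbasisDiag hA M i = RCLike.re M.trace := by
  simpa [cfc_const_one ℝ A hA.isSelfAdjoint] using (re_trace_mul_cfc hA M fun _ => 1).symm

theorem eigenbasisDiag_nonneg (hA : A.IsHermitian) {M : Matrix d d 𝕜} (hM : M.PosSemidef)
    (i : d) : 0 ≤ eigenbasisDiag hA M i :=
  (RCLike.nonneg_iff.1 (hM.conjTranspose_mul_mul_same _).diag_nonneg).1

theorem continuous_eigenbasisDiag (hA : A.IsHermitian) (i : d) :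
    Continuous (eigenbasisDiag hA · i) :=
  RCLike.continuous_re.comp
    (((continuous_const.matrix_mul continuous_id).matrix_mul continuous_const).matrix_elem i i)

theorem re_trace_cfc (hA : A.IsHermitian) (f : ℝ → ℝ) :
    RCLike.re (cfc f A).trace = ∑ i, f (hA.eigenvalues i) := by
  simpa [eigenbasisDiag] using re_trace_mul_cfc hA 1 f

theorem exp_smul_sub_smul_sq (hA : A.IsHermitian) (a g : ℝ) :
    NormedSpace.exp (a • A - g • A ^ 2) = cfc (fun x => Real.exp (a * x - g * x ^ 2)) A := by
  have hsa : IsSelfAdjoint A := hA.isSelfAdjoint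
  have hpoly : cfc (fun x : ℝ => a * x - g * x ^ 2) A = a • A - g • A ^ 2 := by
    rw [cfc_sub _ _ A, cfc_const_mul a _ A, cfc_const_mul g _ A, cfc_pow_id .., cfc_id' ..]
  rw [cfc_comp' Real.exp _ A, CFC.real_exp_eq_normedSpace_exp (cfc_predicate _ A), hpoly]

theorem re_trace_exp_smul (hA : A.IsHermitian) (a : ℝ) :
    RCLike.re (NormedSpace.exp (a • A)).trace = ∑ i, Real.exp (a * hA.eigenvalues i) := by
  simpa [re_trace_cfc hA] using
    congrArg (fun M => RCLike.re M.trace) (exp_smul_sub_smul_sq hA a 0)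

theorem posSemidef_exp (hA : A.IsHermitian) : (NormedSpace.exp A).PosSemidef := by
  have hhalf : (((2 : ℕ) : ℝ)⁻¹ • A).IsHermitian := hA.smul (IsSelfAdjoint.all _)
  rw [← exp_inv_smul_pow A two_ne_zero, pow_two]
  nth_rewrite 1 [← hhalf.exp.eq]
  exact Matrix.posSemidef_conjTranspose_mul_self _

theorem re_trace_exp_nonneg (hA : A.IsHermitian) : 0 ≤ RCLike.re (NormedSpace.exp A).trace :=
  (RCLike.nonneg_iff.1 (posSemidef_exp hA).trace_nonneg).1

theorem norm_eq_norm_eigenvalues (hA : A.IsHermitian) : ‖A‖ = ‖hA.eigenvalues‖ := by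
  conv_lhs => rw [hA.spectral_theorem]
  rw [Unitary.conjStarAlgAut_apply, ← Unitary.coe_star, CStarRing.norm_mul_coe_unitary,
    CStarRing.norm_coe_unitary_mul, Matrix.l2_opNorm_diagonal]
  simp [Pi.norm_def]

theorem abs_eigenvalues_le_norm (hA : A.IsHermitian) (i : d) : |hA.eigenvalues i| ≤ ‖A‖ :=
  (norm_le_pi_norm hA.eigenvalues i).trans_eq (norm_eq_norm_eigenvalues hA).symm

theorem exists_abs_eigenvalues_eq_norm [Nonempty d] (hA : A.IsHermitian) :
    ∃ i, |hA.eigenvalues i| = ‖A‖ := by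
  obtain ⟨i, hi⟩ := Finite.exists_max (|hA.eigenvalues ·|)
  refine ⟨i, (abs_eigenvalues_le_norm hA i).antisymm ?_⟩
  rw [norm_eq_norm_eigenvalues hA]
  exact (pi_norm_le_iff_of_nonneg (abs_nonneg _)).2 hi

theorem exp_norm_le_re_trace_exp_add_re_trace_exp_neg [Nonempty d] (hA : A.IsHermitian) :
    Real.exp ‖A‖ ≤
      RCLike.re (NormedSpace.exp A).trace + RCLike.re (NormedSpace.exp (-A)).trace := by
  obtain ⟨i, hi⟩ := exists_abs_eigenvalues_eq_norm hA
  rw [← one_smul ℝ A, ← neg_smul, re_trace_exp_smul hA, re_trace_exp_smul hA,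
    ← Finset.sum_add_distrib, one_smul, ← hi]
  simp only [one_mul, neg_one_mul]
  exact (Real.exp_abs_le _).trans (Finset.single_le_sum (fun j _ => by positivity)
    (Finset.mem_univ i) (f := fun j => Real.exp (hA.eigenvalues j) +
      Real.exp (-hA.eigenvalues j)))

theorem re_trace_exp_le (hA : A.IsHermitian) :
    RCLike.re (NormedSpace.exp A).trace ≤ Fintype.card d * Real.exp ‖A‖ := by
  rw [← one_smul ℝ A, re_trace_exp_smul hA, one_smul, ← nsmul_eq_mul]
  refine Finset.sum_le_card_nsmul _ _ _ fun i _ => ?_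
  rw [one_mul]
  gcongr
  exact (le_abs_self _).trans (abs_eigenvalues_le_norm hA i)

end Spectral

section CenteredBounded

variable {E : Type*} [MeasurableSpace E] {P : Measure E} {ξ : E → ℝ} {R v : ℝ}

/-- A centred real random variable that is bounded by `R` and has variance at most `v`, as in
Bernstein's inequality. -/
structure IsCenteredBounded (P : Measure E) (ξ : E → ℝ) (R v : ℝ) : Prop where
  aemeasurable : AEMeasurable ξ P
  ae_abs_le : ∀ᵐ ω ∂P, |ξ ω| ≤ R
  integral_eq_zero : ∫ ω, ξ ω ∂P = 0
  integral_sq_le : ∫ ω, ξ ω ^ 2 ∂P ≤ v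

theorem integrable_continuous_comp_of_bounded [IsFiniteMeasure P] {X : Type*}
    [NormedAddCommGroup X] [ProperSpace X] [MeasurableSpace X] [OpensMeasurableSpace X] {Y : E → X}
    (hY : AEMeasurable Y P) {C : ℝ} (hC : ∀ᵐ ω ∂P, ‖Y ω‖ ≤ C) {f : X → ℝ} (hf : Continuous f) :
    Integrable (fun ω => f (Y ω)) P := by
  obtain ⟨K, hK⟩ := (isCompact_closedBall (0 : X) C).exists_bound_of_continuousOn hf.continuousOn
  refine .of_bound (hf.measurable.comp_aemeasurable hY).aestronglyMeasurable K ?_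
  filter_upwards [hC] with ω hω using hK _ (mem_closedBall_zero_iff.2 hω)

theorem IsCenteredBounded.integrable_continuous_comp [IsFiniteMeasure P]
    (hξ : IsCenteredBounded P ξ R v) {f : ℝ → ℝ} (hf : Continuous f) :
    Integrable (fun ω => f (ξ ω)) P :=
  integrable_continuous_comp_of_bounded hξ.aemeasurable hξ.ae_abs_le hf

theorem IsCenteredBounded.ae_norm_pi_le_abs {κ : Type*} [Fintype κ] {ξ : κ → E → ℝ}
    (hξ : ∀ k, IsCenteredBounded P (ξ k) R v) : ∀ᵐ ω ∂P, ‖fun k => ξ k ω‖ ≤ |R| := by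
  filter_upwards [ae_all_iff.2 fun k => (hξ k).ae_abs_le] with ω hω
  exact (pi_norm_le_iff_of_nonneg (abs_nonneg R)).2 fun k => (hω k).trans (le_abs_self R)

theorem IsCenteredBounded.integrable_continuous_comp_pi [IsFiniteMeasure P] {κ : Type*} [Finite κ]
    {ξ : κ → E → ℝ} (hξ : ∀ k, IsCenteredBounded P (ξ k) R v) {f : (κ → ℝ) → ℝ}
    (hf : Continuous f) : Integrable (fun ω => f fun k => ξ k ω) P := by
  cases nonempty_fintype κ
  exact integrable_continuous_comp_of_bounded
    (aemeasurable_pi_lambda _ fun k => (hξ k).aemeasurable) (ae_norm_pi_le_abs hξ) hf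

theorem IsCenteredBounded.bound_nonneg [NeZero P] (hξ : IsCenteredBounded P ξ R v) : 0 ≤ R :=
  let ⟨_, hω⟩ := hξ.ae_abs_le.exists
  (abs_nonneg _).trans hω

theorem IsCenteredBounded.variance_bound_nonneg (hξ : IsCenteredBounded P ξ R v) : 0 ≤ v :=
  (integral_nonneg fun _ => sq_nonneg _).trans hξ.integral_sq_le

theorem IsCenteredBounded.mgf_le [IsProbabilityMeasure P] (hξ : IsCenteredBounded P ξ R v) {s : ℝ}
    (hs : |s| * R ≤ 1) : mgf ξ P s ≤ Real.exp (s ^ 2 * v) := by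
  have hint : Integrable ξ P := hξ.integrable_continuous_comp continuous_id
  have hint_sq : Integrable (fun ω => ξ ω ^ 2) P :=
    hξ.integrable_continuous_comp (continuous_pow 2)
  have hquad : ∀ᵐ ω ∂P, Real.exp (s * ξ ω) ≤ 1 + s * ξ ω + s ^ 2 * ξ ω ^ 2 := by
    filter_upwards [hξ.ae_abs_le] with ω hω
    have hle : |s * ξ ω| ≤ 1 := by
      rw [abs_mul]
      exact (by gcongr : |s| * |ξ ω| ≤ |s| * R).trans hs
    linarith [(abs_le.1 (Real.abs_exp_sub_one_sub_id_le hle)).2, mul_pow s (ξ ω) 2]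
  calc mgf ξ P s
      ≤ ∫ ω, (1 + s * ξ ω + s ^ 2 * ξ ω ^ 2) ∂P :=
        integral_mono_ae
          (hξ.integrable_continuous_comp (f := fun x => Real.exp (s * x)) (by fun_prop))
          (by fun_prop) hquad
    _ = 1 + s ^ 2 * ∫ ω, ξ ω ^ 2 ∂P := by
        rw [integral_add (by fun_prop) (by fun_prop), integral_add (by fun_prop) (by fun_prop),
          integral_const_mul, integral_const_mul, hξ.integral_eq_zero]
        simp
    _ ≤ 1 + s ^ 2 * v := by gcongr; exact hξ.integral_sq_le
    _ ≤ Real.exp (s ^ 2 * v) := by linarith [Real.add_one_le_exp (s ^ 2 * v)]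

theorem IsCenteredBounded.integral_exp_sub_le_one [IsProbabilityMeasure P]
    (hξ : IsCenteredBounded P ξ R v) {s : ℝ} (hs : |s| * R ≤ 1) :
    ∫ ω, Real.exp (s * ξ ω - s ^ 2 * v) ∂P ≤ 1 := by
  simp only [Real.exp_sub, integral_div]
  exact div_le_one_of_le₀ (hξ.mgf_le hs) (Real.exp_pos _).le

theorem integral_sum_mul_le_of_integral_le_one {ι : Type*} {s : Finset ι} {f w : ι → E → ℝ}
    (hf : ∀ i ∈ s, Integrable (f i) P) (hw : ∀ i ∈ s, Integrable (w i) P)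
    (hindep : ∀ i ∈ s, IndepFun (f i) (w i) P) (hf_le : ∀ i ∈ s, ∫ ω, f i ω ∂P ≤ 1)
    (hw_nonneg : ∀ i ∈ s, 0 ≤ w i) :
    ∫ ω, ∑ i ∈ s, f i ω * w i ω ∂P ≤ ∫ ω, ∑ i ∈ s, w i ω ∂P := by
  have hmul : ∀ i ∈ s, Integrable (fun ω => f i ω * w i ω) P := fun i hi =>
    (hindep i hi).integrable_mul (hf i hi) (hw i hi)
  rw [integral_finsetSum _ hmul, integral_finsetSum _ hw]
  refine Finset.sum_le_sum fun i hi => ?_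
  rw [(hindep i hi).integral_fun_mul_eq_mul_integral (hf i hi).aestronglyMeasurable
    (hw i hi).aestronglyMeasurable]
  exact mul_le_of_le_one_left (integral_nonneg (hw_nonneg i hi)) (hf_le i hi)

end CenteredBounded

section TraceMoments

variable {E 𝕜 d : Type*} [MeasurableSpace E] {P : Measure E} [IsProbabilityMeasure P] [RCLike 𝕜]
  [Fintype d] [DecidableEq d] {R v : ℝ}

theorem re_trace_exp_add_smul_le {Y A : Matrix d d 𝕜} (hY : Y.IsHermitian) (hA : A.IsHermitian)
    (a g : ℝ) :
    RCLike.re (NormedSpace.exp (Y + a • A)).trace ≤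
      ∑ i, Real.exp (a * hA.eigenvalues i - g * hA.eigenvalues i ^ 2) *
        eigenbasisDiag hA (NormedSpace.exp (Y + g • A ^ 2)) i := by
  have hsq : (g • A ^ 2).IsHermitian := (hA.pow 2).smul (IsSelfAdjoint.all g)
  have hsmul : (a • A).IsHermitian := hA.smul (IsSelfAdjoint.all a)
  rw [← re_trace_mul_cfc hA _ fun x => Real.exp (a * x - g * x ^ 2), ← exp_smul_sub_smul_sq hA]
  simpa using re_trace_exp_add_le (hY.add hsq) (hsmul.sub hsq)

theorem IsCenteredBounded.integral_exp_eigenvalues_le_one {ξ : E → ℝ}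
    (hξ : IsCenteredBounded P ξ R v) {A : Matrix d d 𝕜} (hA : A.IsHermitian) {θ : ℝ}
    (hθ : |θ| * R * ‖A‖ ≤ 1) (i : d) :
    ∫ ω, Real.exp (θ * ξ ω * hA.eigenvalues i - θ ^ 2 * v * hA.eigenvalues i ^ 2) ∂P ≤ 1 := by
  have hs : |θ * hA.eigenvalues i| * R ≤ 1 := by
    refine le_trans ?_ hθ
    rw [abs_mul, mul_right_comm]
    have := hξ.bound_nonneg
    gcongr
    exact abs_eigenvalues_le_norm hA i
  convert hξ.integral_exp_sub_le_one hs using 4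
  ring

/-- Golden–Thompson splits off the factor `exp (θ ξ A - θ² v A²)`, whose mean is at most `1`
along each eigenvector of `A`. -/
theorem integral_re_trace_exp_add_smul_le {V : Type*} [NormedAddCommGroup V] [ProperSpace V]
    [MeasurableSpace V] [OpensMeasurableSpace V] {X : E → V} {C : ℝ} (hX : AEMeasurable X P)
    (hXC : ∀ᵐ ω ∂P, ‖X ω‖ ≤ C) {F : V → Matrix d d 𝕜} (hF : Continuous F)
    (hFherm : ∀ x, (F x).IsHermitian) {ξ : E → ℝ} (hξ : IsCenteredBounded P ξ R v)
    (hindep : IndepFun X ξ P) {A : Matrix d d 𝕜} (hA : A.IsHermitian) {θ : ℝ}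
    (hθ : |θ| * R * ‖A‖ ≤ 1) :
    ∫ ω, RCLike.re (NormedSpace.exp (F (X ω) + (θ * ξ ω) • A)).trace ∂P ≤
      ∫ ω, RCLike.re (NormedSpace.exp (F (X ω) + (θ ^ 2 * v) • A ^ 2)).trace ∂P := by
  set g := θ ^ 2 * v
  let e (i : d) (x : ℝ) : ℝ := Real.exp (θ * x * hA.eigenvalues i - g * hA.eigenvalues i ^ 2)
  let w (i : d) (x : V) : ℝ := eigenbasisDiag hA (NormedSpace.exp (F x + g • A ^ 2)) i
  have he (i : d) : Continuous (e i) := by fun_prop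
  have hw (i : d) : Continuous (w i) :=
    (continuous_eigenbasisDiag hA i).comp (continuous_exp.comp (hF.add continuous_const))
  have he_int (i : d) : Integrable (fun ω => e i (ξ ω)) P :=
    hξ.integrable_continuous_comp (he i)
  have hw_int (i : d) : Integrable (fun ω => w i (X ω)) P :=
    integrable_continuous_comp_of_bounded hX hXC (hw i)
  have hw_nonneg (i : d) (ω : E) : 0 ≤ w i (X ω) :=
    eigenbasisDiag_nonneg hA (posSemidef_exp
      ((hFherm _).add ((hA.pow 2).smul (IsSelfAdjoint.all g)))) i
  have hindep_comp (i : d) : IndepFun (fun ω => e i (ξ ω)) (fun ω => w i (X ω)) P :=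
    hindep.symm.comp (he i).measurable (hw i).measurable
  have hmul_int : Integrable (fun ω => ∑ i, e i (ξ ω) * w i (X ω)) P :=
    integrable_finsetSum _ fun i _ => (hindep_comp i).integrable_mul (he_int i) (hw_int i)
  calc ∫ ω, RCLike.re (NormedSpace.exp (F (X ω) + (θ * ξ ω) • A)).trace ∂P
      ≤ ∫ ω, ∑ i, e i (ξ ω) * w i (X ω) ∂P :=
        integral_mono_of_nonneg
          (.of_forall fun ω => re_trace_exp_nonneg ((hFherm _).add (hA.smul (IsSelfAdjoint.all _))))
          hmul_int (.of_forall fun ω => re_trace_exp_add_smul_le (hFherm _) hA _ _)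
    _ ≤ ∫ ω, ∑ i, w i (X ω) ∂P :=
        integral_sum_mul_le_of_integral_le_one (fun i _ => he_int i) (fun i _ => hw_int i)
          (fun i _ => hindep_comp i) (fun i _ => hξ.integral_exp_eigenvalues_le_one hA hθ i)
          (fun i _ => hw_nonneg i)
    _ = ∫ ω, RCLike.re (NormedSpace.exp (F (X ω) + g • A ^ 2)).trace ∂P := by
        simp only [w, sum_eigenbasisDiag]

end TraceMoments

section Bernstein

variable {E ι 𝕜 d : Type*} [MeasurableSpace E] {P : Measure E} [IsProbabilityMeasure P]
  [RCLike 𝕜] [Fintype d] [DecidableEq d] {ξ : ι → E → ℝ} {R v θ : ℝ} {A : ι → Matrix d d 𝕜}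
  {s : Finset ι}

theorem integral_re_trace_exp_add_sum_le {D : Matrix d d 𝕜} (hD : D.IsHermitian)
    (hindep : iIndepFun ξ P) (hξ : ∀ k, IsCenteredBounded P (ξ k) R v)
    (hA : ∀ k ∈ s, (A k).IsHermitian) (hθ : ∀ k ∈ s, |θ| * R * ‖A k‖ ≤ 1) :
    ∫ ω, RCLike.re (NormedSpace.exp (D + θ • ∑ k ∈ s, ξ k ω • A k)).trace ∂P ≤
      RCLike.re (NormedSpace.exp (D + (θ ^ 2 * v) • ∑ k ∈ s, A k ^ 2)).trace := by
  classical
  induction s using Finset.induction_on generalizing D with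
  | empty => simp
  | insert k s hk ih =>
    rw [Finset.forall_mem_insert] at hA hθ
    obtain ⟨hAk, hAs⟩ := hA
    obtain ⟨hθk, hθs⟩ := hθ
    let X (ω : E) (j : s) : ℝ := ξ j ω
    let F (x : s → ℝ) : Matrix d d 𝕜 := D + θ • ∑ j, x j • A j
    have hF : Continuous F := by fun_prop
    have hFherm (x : s → ℝ) : (F x).IsHermitian := by
      have hsum : (∑ j, x j • A j).IsHermitian := isSelfAdjoint_sum _ fun (j : s) _ =>
        (hAs j j.2).smul (IsSelfAdjoint.all (x j))
      exact hD.add (hsum.smul (IsSelfAdjoint.all θ))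
    have hF_eq (ω : E) : F (X ω) = D + θ • ∑ j ∈ s, ξ j ω • A j := by
      rw [← Finset.sum_coe_sort s]
    have hX : AEMeasurable X P := aemeasurable_pi_lambda _ fun j => (hξ j).aemeasurable
    have hX_le : ∀ᵐ ω ∂P, ‖X ω‖ ≤ |R| := IsCenteredBounded.ae_norm_pi_le_abs fun j : s => hξ j
    have hX_indep : IndepFun X (ξ k) P :=
      (hindep.indepFun_finset₀ s {k} (Finset.disjoint_singleton_right.2 hk)
        fun j => (hξ j).aemeasurable).comp measurable_id
          (measurable_pi_apply (⟨k, Finset.mem_singleton_self k⟩ : ({k} : Finset ι)))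
    calc ∫ ω, RCLike.re (NormedSpace.exp (D + θ • ∑ j ∈ insert k s, ξ j ω • A j)).trace ∂P
        = ∫ ω, RCLike.re (NormedSpace.exp (F (X ω) + (θ * ξ k ω) • A k)).trace ∂P := by
          simp only [hF_eq, Finset.sum_insert hk, smul_add, smul_smul, add_right_comm, ← add_assoc]
      _ ≤ ∫ ω, RCLike.re (NormedSpace.exp (F (X ω) + (θ ^ 2 * v) • A k ^ 2)).trace ∂P :=
          integral_re_trace_exp_add_smul_le hX hX_le hF hFherm (hξ k) hX_indep hAk hθk
      _ ≤ RCLike.re (NormedSpace.exp (D + (θ ^ 2 * v) • A k ^ 2 +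
            (θ ^ 2 * v) • ∑ j ∈ s, A j ^ 2)).trace := by
          simpa only [hF_eq, add_right_comm] using
            ih (hD.add ((hAk.pow 2).smul (IsSelfAdjoint.all _))) hAs hθs
      _ = RCLike.re (NormedSpace.exp (D + (θ ^ 2 * v) • ∑ j ∈ insert k s, A j ^ 2)).trace := by
          rw [Finset.sum_insert hk, smul_add, add_assoc]

theorem integral_re_trace_exp_smul_sum_le [Fintype ι] (hindep : iIndepFun ξ P)
    (hξ : ∀ k, IsCenteredBounded P (ξ k) R v) (hA : ∀ k, (A k).IsHermitian)
    (hθ : ∀ k, |θ| * R * ‖A k‖ ≤ 1) :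
    ∫ ω, RCLike.re (NormedSpace.exp (θ • ∑ k, ξ k ω • A k)).trace ∂P ≤
      Fintype.card d * Real.exp (θ ^ 2 * v * ‖∑ k, A k ^ 2‖) := by
  have hsq : (∑ k, A k ^ 2).IsHermitian := isSelfAdjoint_sum _ fun k _ => (hA k).pow 2
  have hnorm : ‖(θ ^ 2 * v) • ∑ k, A k ^ 2‖ = θ ^ 2 * v * ‖∑ k, A k ^ 2‖ := by
    cases isEmpty_or_nonempty ι
    · simp
    · have hv := (hξ (Classical.arbitrary ι)).variance_bound_nonneg
      exact norm_smul_of_nonneg (by positivity) _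
  calc ∫ ω, RCLike.re (NormedSpace.exp (θ • ∑ k, ξ k ω • A k)).trace ∂P
      ≤ RCLike.re (NormedSpace.exp ((θ ^ 2 * v) • ∑ k, A k ^ 2)).trace := by
        simpa only [zero_add] using integral_re_trace_exp_add_sum_le (s := Finset.univ)
          Matrix.isHermitian_zero hindep hξ (fun k _ => hA k) (fun k _ => hθ k)
    _ ≤ Fintype.card d * Real.exp (θ ^ 2 * v * ‖∑ k, A k ^ 2‖) := by
        rw [← hnorm]
        exact re_trace_exp_le (hsq.smul (IsSelfAdjoint.all _))

theorem mgf_norm_sum_smul_le [Nonempty d] [Fintype ι] (hindep : iIndepFun ξ P)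
    (hξ : ∀ k, IsCenteredBounded P (ξ k) R v) (hA : ∀ k, (A k).IsHermitian)
    (hθ : ∀ k, |θ| * R * ‖A k‖ ≤ 1) :
    mgf (fun ω => ‖∑ k, ξ k ω • A k‖) P θ ≤
      2 * Fintype.card d * Real.exp (θ ^ 2 * v * ‖∑ k, A k ^ 2‖) := by
  set S : (ι → ℝ) → Matrix d d 𝕜 := fun x => ∑ k, x k • A k
  have hS_herm (x : ι → ℝ) : (θ • S x).IsHermitian :=
    Matrix.IsHermitian.smul (isSelfAdjoint_sum _ fun k _ => (hA k).smul (IsSelfAdjoint.all (x k)))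
      (IsSelfAdjoint.all θ)
  have hint (η : ℝ) : Integrable (fun ω => RCLike.re (NormedSpace.exp (η • S (ξ · ω))).trace) P :=
    IsCenteredBounded.integrable_continuous_comp_pi hξ
      (f := fun x => RCLike.re (NormedSpace.exp (η • S x)).trace)
      (continuous_re_trace_exp.comp (by fun_prop))
  have hexp_le (ω : E) : Real.exp (θ * ‖S (ξ · ω)‖) ≤
      RCLike.re (NormedSpace.exp (θ • S (ξ · ω))).trace +
        RCLike.re (NormedSpace.exp (-θ • S (ξ · ω))).trace := by
    rw [neg_smul]
    refine le_trans ?_ (exp_norm_le_re_trace_exp_add_re_trace_exp_neg (hS_herm (ξ · ω)))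
    rw [norm_smul]
    gcongr
    exact le_abs_self θ
  calc mgf (fun ω => ‖S (ξ · ω)‖) P θ
      ≤ ∫ ω, (RCLike.re (NormedSpace.exp (θ • S (ξ · ω))).trace +
          RCLike.re (NormedSpace.exp (-θ • S (ξ · ω))).trace) ∂P :=
        integral_mono_of_nonneg (.of_forall fun ω => (Real.exp_pos _).le)
          ((hint θ).add (hint (-θ))) (.of_forall hexp_le)
    _ ≤ Fintype.card d * Real.exp (θ ^ 2 * v * ‖∑ k, A k ^ 2‖) +
          Fintype.card d * Real.exp ((-θ) ^ 2 * v * ‖∑ k, A k ^ 2‖) := by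
        rw [integral_add (hint θ) (hint (-θ))]
        exact add_le_add (integral_re_trace_exp_smul_sum_le hindep hξ hA hθ)
          (integral_re_trace_exp_smul_sum_le hindep hξ hA (by rwa [abs_neg]))
    _ = 2 * Fintype.card d * Real.exp (θ ^ 2 * v * ‖∑ k, A k ^ 2‖) := by rw [neg_sq]; ring

theorem measureReal_le_norm_sum_smul_isHermitian_le [Nonempty d] [Fintype ι]
    (hindep : iIndepFun ξ P) (hξ : ∀ k, IsCenteredBounded P (ξ k) R v)
    (hA : ∀ k, (A k).IsHermitian) (hθ_nonneg : 0 ≤ θ) (hθ : ∀ k, θ * R * ‖A k‖ ≤ 1) (t : ℝ) :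
    P.real {ω | t ≤ ‖∑ k, ξ k ω • A k‖} ≤
      2 * Fintype.card d * Real.exp (θ ^ 2 * v * ‖∑ k, A k ^ 2‖ - θ * t) := by
  have hint : Integrable (fun ω => Real.exp (θ * ‖∑ k, ξ k ω • A k‖)) P :=
    IsCenteredBounded.integrable_continuous_comp_pi hξ
      (f := fun x => Real.exp (θ * ‖∑ k, x k • A k‖)) (by fun_prop)
  have hmgf := mgf_norm_sum_smul_le hindep hξ hA (by rwa [abs_of_nonneg hθ_nonneg])
  calc P.real {ω | t ≤ ‖∑ k, ξ k ω • A k‖}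
      ≤ Real.exp (-θ * t) * mgf (fun ω => ‖∑ k, ξ k ω • A k‖) P θ :=
        measure_ge_le_exp_mul_mgf t hθ_nonneg hint
    _ ≤ Real.exp (-θ * t) * (2 * Fintype.card d * Real.exp (θ ^ 2 * v * ‖∑ k, A k ^ 2‖)) := by
        gcongr
    _ = 2 * Fintype.card d * Real.exp (θ ^ 2 * v * ‖∑ k, A k ^ 2‖ - θ * t) := by
        rw [sub_eq_add_neg, Real.exp_add, neg_mul]
        ring

end Bernstein

section Dilation

variable {𝕜 m n : Type*} [RCLike 𝕜]

/-- The Hermitian dilation of a rectangular matrix, which has the same spectral norm. -/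
def hermitianDilation : Matrix m n 𝕜 →ₗ[ℝ] Matrix (m ⊕ n) (m ⊕ n) 𝕜 where
  toFun B := Matrix.fromBlocks 0 B Bᴴ 0
  map_add' B C := by simp [Matrix.fromBlocks_add]
  map_smul' r B := by simp [Matrix.fromBlocks_smul, Matrix.conjTranspose_smul]

theorem hermitianDilation_apply (B : Matrix m n 𝕜) :
    hermitianDilation B = Matrix.fromBlocks 0 B Bᴴ 0 := rfl

theorem isHermitian_hermitianDilation (B : Matrix m n 𝕜) : (hermitianDilation B).IsHermitian := by
  simp [hermitianDilation_apply, Matrix.IsHermitian, Matrix.fromBlocks_conjTranspose]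

variable [Fintype m] [Fintype n] [DecidableEq n]

theorem sum_norm_mulVec_sq_le (M : Matrix m n 𝕜) (x : n → 𝕜) :
    ∑ i, ‖(M *ᵥ x) i‖ ^ 2 ≤ ‖M‖ ^ 2 * ∑ j, ‖x j‖ ^ 2 := by
  simpa [mul_pow, EuclideanSpace.norm_sq_eq] using
    pow_le_pow_left₀ (norm_nonneg _) (Matrix.l2_opNorm_mulVec M (WithLp.toLp 2 x)) 2

theorem norm_le_of_sum_norm_mulVec_sq_le {M : Matrix m n 𝕜} {C : ℝ} (hC : 0 ≤ C)
    (hM : ∀ x, ∑ i, ‖(M *ᵥ x) i‖ ^ 2 ≤ C ^ 2 * ∑ j, ‖x j‖ ^ 2) : ‖M‖ ≤ C := by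
  refine (Matrix.toEuclideanLin M).toContinuousLinearMap.opNorm_le_bound hC fun x => ?_
  refine le_of_sq_le_sq ?_ (mul_nonneg hC (norm_nonneg x))
  rw [mul_pow, EuclideanSpace.norm_sq_eq, EuclideanSpace.norm_sq_eq]
  exact hM x.ofLp

variable [DecidableEq m]

theorem hermitianDilation_sq (B : Matrix m n 𝕜) :
    hermitianDilation B ^ 2 = Matrix.fromBlocks (B * Bᴴ) 0 0 (Bᴴ * B) := by
  simp [hermitianDilation_apply, pow_two, Matrix.fromBlocks_multiply]

theorem sum_hermitianDilation_sq {ι : Type*} (s : Finset ι) (B : ι → Matrix m n 𝕜) :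
    ∑ k ∈ s, hermitianDilation (B k) ^ 2 =
      Matrix.fromBlocks (∑ k ∈ s, B k * (B k)ᴴ) 0 0 (∑ k ∈ s, (B k)ᴴ * B k) := by
  simp only [hermitianDilation_sq]
  ext (i | i) (j | j) <;> simp [Matrix.sum_apply]

theorem norm_fromBlocks_diagonal_le {X : Matrix m m 𝕜} {Y : Matrix n n 𝕜} {C : ℝ} (hX : ‖X‖ ≤ C)
    (hY : ‖Y‖ ≤ C) : ‖Matrix.fromBlocks X 0 0 Y‖ ≤ C := by
  refine norm_le_of_sum_norm_mulVec_sq_le ((norm_nonneg X).trans hX) fun x => ?_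
  have hXx := sum_norm_mulVec_sq_le X fun i => x (Sum.inl i)
  have hYx := sum_norm_mulVec_sq_le Y fun i => x (Sum.inr i)
  simp only [Matrix.fromBlocks_mulVec, Fintype.sum_sum_type, Sum.elim_inl, Sum.elim_inr,
    Matrix.zero_mulVec, add_zero, zero_add, mul_add]
  exact add_le_add (hXx.trans (by gcongr)) (hYx.trans (by gcongr))

theorem norm_le_norm_fromBlocks (X : Matrix m m 𝕜) (B : Matrix m n 𝕜) (C : Matrix n m 𝕜)
    (Y : Matrix n n 𝕜) : ‖B‖ ≤ ‖Matrix.fromBlocks X B C Y‖ := by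
  refine norm_le_of_sum_norm_mulVec_sq_le (norm_nonneg _) fun x => ?_
  have h := sum_norm_mulVec_sq_le (Matrix.fromBlocks X B C Y) (Sum.elim 0 x)
  simp only [Matrix.fromBlocks_mulVec, Fintype.sum_sum_type, Sum.elim_inl, Sum.elim_inr,
    Sum.elim_comp_inl, Sum.elim_comp_inr, Matrix.mulVec_zero, Pi.zero_apply, norm_zero, ne_eq,
    OfNat.ofNat_ne_zero, not_false_eq_true, zero_pow, Finset.sum_const_zero, zero_add] at h
  exact (le_add_of_nonneg_right (by positivity)).trans h

theorem norm_hermitianDilation (B : Matrix m n 𝕜) : ‖hermitianDilation B‖ = ‖B‖ := by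
  refine le_antisymm (le_of_sq_le_sq ?_ (norm_nonneg B)) (norm_le_norm_fromBlocks ..)
  have hD : IsSelfAdjoint (hermitianDilation B) := isHermitian_hermitianDilation B
  calc ‖hermitianDilation B‖ ^ 2
      = ‖Matrix.fromBlocks (B * Bᴴ) 0 0 (Bᴴ * B)‖ := by
        rw [← hD.norm_mul_self, ← pow_two, hermitianDilation_sq]
    _ ≤ ‖B‖ ^ 2 := by
        have hB := Matrix.l2_opNorm_conjTranspose_mul_self Bᴴ
        rw [Matrix.conjTranspose_conjTranspose, Matrix.l2_opNorm_conjTranspose] at hB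
        rw [pow_two]
        exact norm_fromBlocks_diagonal_le hB.le (Matrix.l2_opNorm_conjTranspose_mul_self B).le

end Dilation

section RectangularBernstein

variable {E ι 𝕜 m n : Type*} [MeasurableSpace E] {P : Measure E} [IsProbabilityMeasure P]
  [Fintype ι] [RCLike 𝕜] [Fintype m] [Fintype n] [DecidableEq m] [DecidableEq n]
  [Nonempty (m ⊕ n)] {ξ : ι → E → ℝ} {R v L σ : ℝ} {B : ι → Matrix m n 𝕜}

theorem measureReal_le_norm_sum_smul_le (hindep : iIndepFun ξ P)
    (hξ : ∀ k, IsCenteredBounded P (ξ k) R v) (hv : 0 ≤ v) (hB : ∀ k, ‖B k‖ ≤ L)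
    (hrow : ‖∑ k, B k * (B k)ᴴ‖ ≤ σ ^ 2) (hcol : ‖∑ k, (B k)ᴴ * B k‖ ≤ σ ^ 2) {θ : ℝ}
    (hθ_nonneg : 0 ≤ θ) (hθ : θ * (R * L) ≤ 1) (t : ℝ) :
    P.real {ω | t ≤ ‖∑ k, ξ k ω • B k‖} ≤
      2 * (Fintype.card m + Fintype.card n) * Real.exp (θ ^ 2 * v * σ ^ 2 - θ * t) := by
  have hnorm (ω : E) : ‖∑ k, ξ k ω • B k‖ = ‖∑ k, ξ k ω • hermitianDilation (B k)‖ := by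
    simp only [← norm_hermitianDilation (∑ k, ξ k ω • B k), map_sum, map_smul]
  have hθ_dilation (k : ι) : θ * R * ‖hermitianDilation (B k)‖ ≤ 1 := by
    have hR := (hξ k).bound_nonneg
    rw [norm_hermitianDilation, mul_assoc]
    exact le_trans (by gcongr; exact hB k) hθ
  have hsq : ‖∑ k, hermitianDilation (B k) ^ 2‖ ≤ σ ^ 2 := by
    rw [sum_hermitianDilation_sq]
    exact norm_fromBlocks_diagonal_le hrow hcol
  calc P.real {ω | t ≤ ‖∑ k, ξ k ω • B k‖}
      = P.real {ω | t ≤ ‖∑ k, ξ k ω • hermitianDilation (B k)‖} := by simp only [hnorm]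
    _ ≤ 2 * Fintype.card (m ⊕ n) *
          Real.exp (θ ^ 2 * v * ‖∑ k, hermitianDilation (B k) ^ 2‖ - θ * t) :=
        measureReal_le_norm_sum_smul_isHermitian_le hindep hξ
          (fun k => isHermitian_hermitianDilation (B k)) hθ_nonneg hθ_dilation t
    _ ≤ 2 * (Fintype.card m + Fintype.card n) * Real.exp (θ ^ 2 * v * σ ^ 2 - θ * t) := by
        rw [Fintype.card_sum, Nat.cast_add]
        gcongr

theorem exists_bernstein_parameter {a b r : ℝ} (ha : 0 < a) (hb : 0 ≤ b) (hr : 0 ≤ r) :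
    ∃ θ, 0 ≤ θ ∧ θ * a ≤ 1 ∧ θ * b ≤ r ∧ θ * (r * a + b) = r := by
  obtain rfl | hr := hr.eq_or_lt
  · exact ⟨0, by simp⟩
  have hd : 0 < r * a + b := by positivity
  refine ⟨r / (r * a + b), by positivity, ?_, ?_, div_mul_cancel₀ r hd.ne'⟩
  · rw [div_mul_eq_mul_div, div_le_one hd]
    exact le_add_of_nonneg_right hb
  · rw [div_mul_eq_mul_div, mul_div_assoc]
    exact mul_le_of_le_one_right hr.le
      ((div_le_one hd).2 (le_add_of_nonneg_left (by positivity)))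

theorem measureReal_bernstein_le_norm_sum_smul_le (hindep : iIndepFun ξ P)
    (hξ : ∀ k, IsCenteredBounded P (ξ k) R v) (hv : 0 ≤ v) (hB : ∀ k, ‖B k‖ ≤ L)
    (hrow : ‖∑ k, B k * (B k)ᴴ‖ ≤ σ ^ 2) (hcol : ‖∑ k, (B k)ᴴ * B k‖ ≤ σ ^ 2)
    (hRL : 0 < R * L) (hσ : 0 ≤ σ) {ℓ : ℝ} (hℓ : 0 ≤ ℓ) (c : ℝ) :
    P.real {ω | c * (R * L * ℓ + √(v * ℓ) * σ) ≤ ‖∑ k, ξ k ω • B k‖} ≤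
      2 * (Fintype.card m + Fintype.card n) * Real.exp (ℓ - c * ℓ) := by
  obtain ⟨θ, hθ_nonneg, hθ, hθ_le, hθ_eq⟩ := exists_bernstein_parameter hRL
    (mul_nonneg (Real.sqrt_nonneg v) hσ) (Real.sqrt_nonneg ℓ)
  have hquad : θ ^ 2 * v * σ ^ 2 ≤ ℓ := by
    have h := pow_le_pow_left₀ (by positivity) hθ_le 2
    rwa [mul_pow, mul_pow, Real.sq_sqrt hv, Real.sq_sqrt hℓ, ← mul_assoc] at h
  have hlin : θ * (c * (R * L * ℓ + √(v * ℓ) * σ)) = c * ℓ := by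
    rw [Real.sqrt_mul hv]
    linear_combination c * √ℓ * hθ_eq + c * (1 - θ * (R * L)) * Real.sq_sqrt hℓ
  refine (measureReal_le_norm_sum_smul_le hindep hξ hv hB hrow hcol hθ_nonneg hθ _).trans ?_
  rw [hlin]
  gcongr

end RectangularBernstein

section SingleEntries

variable {R m n : Type*} [NonUnitalSemiring R] [StarRing R] [Fintype m] [Fintype n]
  [DecidableEq m] [DecidableEq n]

theorem sum_single_mul_conjTranspose (Z : Matrix m n R) :
    ∑ ij : m × n, Matrix.single ij.1 ij.2 (Z ij.1 ij.2) *
      (Matrix.single ij.1 ij.2 (Z ij.1 ij.2))ᴴ =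
        Matrix.diagonal fun i => ∑ j, Z i j * star (Z i j) := by
  simp only [Matrix.conjTranspose_single, Matrix.single_mul_single_same, Fintype.sum_prod_type,
    ← Matrix.sum_single_eq_diagonal]
  simp only [← Matrix.singleAddMonoidHom_apply, map_sum]

theorem sum_conjTranspose_single_mul (Z : Matrix m n R) :
    ∑ ij : m × n, (Matrix.single ij.1 ij.2 (Z ij.1 ij.2))ᴴ *
      Matrix.single ij.1 ij.2 (Z ij.1 ij.2) =
        Matrix.diagonal fun j => ∑ i, star (Z i j) * Z i j := by
  simp only [Matrix.conjTranspose_single, Matrix.single_mul_single_same,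
    Fintype.sum_prod_type_right, ← Matrix.sum_single_eq_diagonal]
  simp only [← Matrix.singleAddMonoidHom_apply, map_sum]

theorem norm_single_le {𝕜 : Type*} [RCLike 𝕜] (i : m) (j : n) (z : 𝕜) :
    ‖Matrix.single i j z‖ ≤ ‖z‖ := by
  refine norm_le_of_sum_norm_mulVec_sq_le (norm_nonneg z) fun x => ?_
  calc ∑ k, ‖(Matrix.single i j z *ᵥ x) k‖ ^ 2
      = ‖z‖ ^ 2 * ‖x j‖ ^ 2 := by
        rw [Finset.sum_eq_single i] <;> simp +contextual [Matrix.single_mulVec, mul_pow]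
    _ ≤ ‖z‖ ^ 2 * ∑ l, ‖x l‖ ^ 2 := by
        gcongr
        exact Finset.single_le_sum (f := fun l => ‖x l‖ ^ 2) (fun l _ => sq_nonneg _)
          (Finset.mem_univ j)

end SingleEntries

section EntrywiseNorms

variable {n : ℕ} (Z : Matrix (Fin n) (Fin n) ℝ)

theorem abs_le_normInf (i j : Fin n) : |Z i j| ≤ normInf Z :=
  le_ciSup (f := fun ij : Fin n × Fin n => |Z ij.1 ij.2|) (Set.finite_range _).bddAbove (i, j)

theorem normInf_nonneg : 0 ≤ normInf Z := Real.iSup_nonneg fun _ => abs_nonneg _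

theorem normInfTwo_nonneg : 0 ≤ normInfTwo Z :=
  le_max_of_le_left (Real.iSup_nonneg fun _ => Real.sqrt_nonneg _)

theorem sum_row_sq_le (i : Fin n) : ∑ b, Z i b ^ 2 ≤ normInfTwo Z ^ 2 := by
  refine (Real.sqrt_le_left (normInfTwo_nonneg Z)).1 (le_max_of_le_left ?_)
  exact le_ciSup (f := fun i => √(∑ b, Z i b ^ 2)) (Set.finite_range _).bddAbove i

theorem sum_col_sq_le (j : Fin n) : ∑ a, Z a j ^ 2 ≤ normInfTwo Z ^ 2 := by
  refine (Real.sqrt_le_left (normInfTwo_nonneg Z)).1 (le_max_of_le_right ?_)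
  exact le_ciSup (f := fun j => √(∑ a, Z a j ^ 2)) (Set.finite_range _).bddAbove j

theorem norm_sum_single_mul_conjTranspose_le :
    ‖∑ ij : Fin n × Fin n, Matrix.single ij.1 ij.2 (Z ij.1 ij.2) *
      (Matrix.single ij.1 ij.2 (Z ij.1 ij.2))ᴴ‖ ≤ normInfTwo Z ^ 2 := by
  rw [sum_single_mul_conjTranspose, Matrix.l2_opNorm_diagonal]
  refine (pi_norm_le_iff_of_nonneg (sq_nonneg _)).2 fun i => ?_
  simp only [star_trivial, ← pow_two]
  rw [Real.norm_of_nonneg (by positivity)]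
  exact sum_row_sq_le Z i

theorem norm_sum_conjTranspose_single_mul_le :
    ‖∑ ij : Fin n × Fin n, (Matrix.single ij.1 ij.2 (Z ij.1 ij.2))ᴴ *
      Matrix.single ij.1 ij.2 (Z ij.1 ij.2)‖ ≤ normInfTwo Z ^ 2 := by
  rw [sum_conjTranspose_single_mul, Matrix.l2_opNorm_diagonal]
  refine (pi_norm_le_iff_of_nonneg (sq_nonneg _)).2 fun j => ?_
  simp only [star_trivial, ← pow_two]
  rw [Real.norm_of_nonneg (by positivity)]
  exact sum_col_sq_le Z j

end EntrywiseNorms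

section Sampling

variable {E : Type*}

/-- The centred relative error `p⁻¹ 1_s - 1` made when a quantity is observed on the event `s` of
probability `p` only and rescaled by `p⁻¹`. -/
noncomputable def samplingNoise (p : ℝ) (s : Set E) (ω : E) : ℝ :=
  p⁻¹ * s.indicator 1 ω - 1

theorem abs_samplingNoise_le {p : ℝ} (hp : 0 < p) (hp' : p ≤ 1) (s : Set E) (ω : E) :
    |samplingNoise p s ω| ≤ p⁻¹ := by
  have h1 : 1 ≤ p⁻¹ := (one_le_inv₀ hp).2 hp'
  by_cases hω : ω ∈ s
  · rw [samplingNoise, Set.indicator_of_mem hω, Pi.one_apply, abs_of_nonneg] <;> linarith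
  · rw [samplingNoise, Set.indicator_of_notMem hω]
    simpa using h1

theorem samplingNoise_sq (p : ℝ) (s : Set E) (ω : E) :
    samplingNoise p s ω ^ 2 = (p⁻¹ - 2) * samplingNoise p s ω + (p⁻¹ - 1) := by
  by_cases hω : ω ∈ s <;> simp [samplingNoise, hω] <;> ring

theorem isCenteredBounded_samplingNoise [MeasurableSpace E] {P : Measure E}
    [IsProbabilityMeasure P] {p : ℝ} (hp : 0 < p) {s : Set E} (hs : MeasurableSet s)
    (hPs : P.real s = p) :
    IsCenteredBounded P (samplingNoise p s) p⁻¹ p⁻¹ := by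
  have hp' : p ≤ 1 := hPs ▸ measureReal_le_one
  have hmeas : Measurable (samplingNoise p s) :=
    ((measurable_one.indicator hs).const_mul p⁻¹).sub_const 1
  have hint : Integrable (samplingNoise p s) P :=
    .of_bound hmeas.aestronglyMeasurable p⁻¹ (.of_forall (abs_samplingNoise_le hp hp' s))
  have hmean : ∫ ω, samplingNoise p s ω ∂P = 0 := by
    simp only [samplingNoise]
    rw [integral_sub (((integrable_const 1).indicator hs).const_mul _) (integrable_const 1),
      integral_const_mul, integral_indicator_one hs, hPs]
    simp [hp.ne']
  refine ⟨hmeas.aemeasurable, .of_forall (abs_samplingNoise_le hp hp' s), hmean, ?_⟩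
  simp only [samplingNoise_sq p]
  rw [integral_add (hint.const_mul _) (integrable_const _), integral_const_mul, hmean]
  simp

theorem IsBernoulliSampling.iIndepFun_samplingNoise [MeasurableSpace E] {P : Measure E} {n : ℕ}
    {p : ℝ} {Ω : E → Set (Fin n × Fin n)} (hΩ : IsBernoulliSampling P p Ω) :
    iIndepFun (fun ij => samplingNoise p {ω | ij ∈ Ω ω}) P :=
  hΩ.indep.iIndepFun_indicator.comp (fun _ x => p⁻¹ * x - 1) fun _ => by fun_prop

theorem rescaledProjOn_sub_self {n : ℕ} (p : ℝ) (Ω : E → Set (Fin n × Fin n))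
    (Z : Matrix (Fin n) (Fin n) ℝ) (ω : E) :
    rescaledProjOn p (Ω ω) Z - Z = ∑ ij : Fin n × Fin n,
      samplingNoise p {ω | ij ∈ Ω ω} ω • Matrix.single ij.1 ij.2 (Z ij.1 ij.2) := by
  classical
  have hcoeff (ij : Fin n × Fin n) : samplingNoise p {ω | ij ∈ Ω ω} ω * Z ij.1 ij.2 =
      (rescaledProjOn p (Ω ω) Z - Z) ij.1 ij.2 := by
    by_cases hij : ij ∈ Ω ω <;> simp [samplingNoise, rescaledProjOn, projOn, hij, sub_mul]
  simp only [Matrix.smul_single, smul_eq_mul, hcoeff, Fintype.sum_prod_type]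
  exact Matrix.matrix_eq_sum_single _

theorem specNorm_rescaledProjOn_sub_self {n : ℕ} (p : ℝ) (Ω : E → Set (Fin n × Fin n))
    (Z : Matrix (Fin n) (Fin n) ℝ) (ω : E) :
    specNorm (rescaledProjOn p (Ω ω) Z - Z) = ‖∑ ij : Fin n × Fin n,
      samplingNoise p {ω | ij ∈ Ω ω} ω • Matrix.single ij.1 ij.2 (Z ij.1 ij.2)‖ := by
  rw [← rescaledProjOn_sub_self]
  rfl

theorem measureReal_lt_specNorm_rescaledProjOn_sub_le [MeasurableSpace E] {P : Measure E}
    [IsProbabilityMeasure P] {n : ℕ} {p : ℝ} (hp : 0 < p) {Ω : E → Set (Fin n × Fin n)}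
    (hΩ : IsBernoulliSampling P p Ω) (Z : Matrix (Fin n) (Fin n) ℝ) {ℓ c : ℝ} (hℓ : 0 ≤ ℓ)
    (hc : 0 ≤ c) :
    P.real {ω | c * (ℓ / p * normInf Z + √(ℓ / p) * normInfTwo Z) <
      specNorm (rescaledProjOn p (Ω ω) Z - Z)} ≤ 4 * n * Real.exp (ℓ - c * ℓ) := by
  obtain hZ | hZ := (normInf_nonneg Z).eq_or_lt
  · have hZ_zero : Z = 0 := by
      ext i j
      exact abs_nonpos_iff.1 (hZ ▸ abs_le_normInf Z i j)
    have hspec (ω : E) : specNorm (rescaledProjOn p (Ω ω) Z - Z) = 0 := by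
      rw [specNorm_rescaledProjOn_sub_self, hZ_zero]
      simp
    have hbound : 0 ≤ c * (ℓ / p * normInf Z + √(ℓ / p) * normInfTwo Z) := by
      have := normInfTwo_nonneg Z
      rw [← hZ]
      positivity
    simp only [hspec, hbound.not_gt, Set.ofPred_false, measureReal_empty]
    positivity
  have : NeZero n := ⟨by rintro rfl; simp [normInf] at hZ⟩
  have hbernstein := measureReal_bernstein_le_norm_sum_smul_le hΩ.iIndepFun_samplingNoise
    (fun ij => isCenteredBounded_samplingNoise hp (hΩ.measurableSet_mem ij) (hΩ.prob_mem ij))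
    (inv_nonneg.2 hp.le)
    (fun ij => (norm_single_le ij.1 ij.2 _).trans (abs_le_normInf Z ij.1 ij.2))
    (norm_sum_single_mul_conjTranspose_le Z) (norm_sum_conjTranspose_single_mul_le Z)
    (mul_pos (inv_pos.2 hp) hZ) (normInfTwo_nonneg Z) hℓ c
  refine (measureReal_mono fun ω hω => ?_).trans (hbernstein.trans_eq ?_)
  · rw [Set.mem_ofPred_eq] at hω ⊢
    rw [← specNorm_rescaledProjOn_sub_self, ← div_eq_inv_mul, ← div_mul_comm, ← div_eq_inv_mul]
    exact hω.le
  · rw [Fintype.card_fin]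
    ring

theorem mul_exp_log_sub_mul_log {x : ℝ} (hx : 0 < x) (a : ℝ) :
    x * Real.exp (Real.log x - (a + 2) * Real.log x) = x ^ (-a) := by
  nth_rewrite 1 [← Real.exp_log hx]
  rw [Real.rpow_def_of_pos hx, ← Real.exp_add]
  ring_nf

end Sampling

end MatrixSampling

theorem mainTheorem5 :
    ∀ c₂ : ℝ, 0 < c₂ → ∃ c : ℝ, 1 < c ∧ ∃ c₁ : ℝ, 0 < c₁ ∧
      ∀ (n : ℕ), 1 ≤ n → ∀ (p : ℝ), 0 < p → p ≤ 1 →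
      ∀ (Z : Matrix (Fin n) (Fin n) ℝ)
        (E : Type*) [MeasurableSpace E] (P : Measure E) [IsProbabilityMeasure P]
        (Ω : E → Set (Fin n × Fin n)), MatrixSampling.IsBernoulliSampling P p Ω →
        1 - c₁ * (n : ℝ) ^ (-c₂) ≤
          P.real {ω | MatrixSampling.specNorm (MatrixSampling.rescaledProjOn p (Ω ω) Z - Z) ≤
            c * (Real.log n / p * MatrixSampling.normInf Z +
              √(Real.log n / p) * MatrixSampling.normInfTwo Z)} := by
  intro c₂ hc₂
  refine ⟨c₂ + 2, by linarith, 4, by norm_num, fun n hn p hp _ Z E _ P _ Ω hΩ => ?_⟩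
  set err : E → ℝ := fun ω => MatrixSampling.specNorm (MatrixSampling.rescaledProjOn p (Ω ω) Z - Z)
  set bound : ℝ := (c₂ + 2) * (Real.log n / p * MatrixSampling.normInf Z +
    √(Real.log n / p) * MatrixSampling.normInfTwo Z)
  have hbad : P.real {ω | bound < err ω} ≤ 4 * (n : ℝ) ^ (-c₂) := by
    rw [← MatrixSampling.mul_exp_log_sub_mul_log (by positivity : (0 : ℝ) < n), ← mul_assoc]
    exact MatrixSampling.measureReal_lt_specNorm_rescaledProjOn_sub_le hp hΩ Z
      (Real.log_natCast_nonneg n) (by linarith)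
  have hcover : {ω | err ω ≤ bound} ∪ {ω | bound < err ω} = Set.univ :=
    Set.eq_univ_of_forall fun ω => le_or_gt (err ω) bound
  have hunion := measureReal_union_le (μ := P) {ω | err ω ≤ bound} {ω | bound < err ω}
  rw [hcover, probReal_univ] at hunion
  linarith
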